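/- Let $\mathcal A$ be the quasi-local $C^*$-algebra of a quantum spin system on $\mathbb Z^\mu$ with spin space $\mathbb C^d$ at each site: $\mathcal A$ is a unital $C^*$-algebra, $\mathcal A\neq\{0\}$, generated by mutually commuting unital copies $\mathcal A_{\{x\}}$ of $M_d(\mathbb C)$, $x\in\mathbb Z^\mu$. For finite $\Lambda\subset\mathbb Z^\mu$ let $\mathcal A_\Lambda$ be the $*$-algebra generated by the $\mathcal A_{\{x\}}$, $x\in\Lambda$ (a local observable is an element of some $\mathcal A_\Lambda$). Let $(\tau_x)_{x\in\mathbb Z^\mu}$ be the group of space translations, the $*$-automorphisms of $\mathcal A$ that carry the copy of $M_d(\mathbb C)$ at $y$ identically onto the copy at $y+x$. Write $\Lambda_x(r)=\{y\in\mathbb Z^\mu : |y_i-x_i|\le r \text{ for all } i\}$. Let $(\hat h_x)_{x\in\mathbb Z^\mu}$ be local Hamiltonians of uniformly bounded range and norm: there are $R\in\mathbb N$ and $N\in\mathbb R$ such that for every $x$, $\hat h_x=\hat h_x^*\in\mathcal A_{\Lambda_x(R)}$ and $\|\hat h_x\|\le N$. For finite $\Lambda\subset\mathbb Z^\mu$ put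 $$\hat H_\Lambda=\sum_{x\in\Lambda}\hat h_x,\qquad \alpha_{\Lambda,t}(A)=e^{it\hat H_\Lambda}Ae^{-it\hat H_\Lambda}\quad(A\in\mathcal A,\ t\in\mathbb R).$$ Let $(\alpha_t)_{t\in\mathbb R}$ be a one-parameter group of $*$-automorphisms of $\mathcal A$ which is translation invariant ($\alpha_t\tau_x=\tau_x\alpha_t$ for all $t,x$), strongly continuous ($\lim_{t\to0}\|\alpha_t(A)-A\|=0$ for every $A\in\mathcal A$) and approximately inner ($\alpha_t(A)=\lim_{\Lambda\uparrow\mathbb Z^\mu}\alpha_{\Lambda,t}(A)$ in norm for all $A\in\mathcal A$, $t\in\mathbb R$, along the net of finite subsets ordered by inclusion). Let $A_0$ be a local observable, $A_x=\tau_x(A_0)$, and $\widehat A_\Lambda=\frac1{|\Lambda|}\sum_{x\in\Lambda}A_x$ for nonempty finite $\Lambda$. Then for every $\varepsilon>0$ and $t_0>0$, the estimate $$\bigl\|\alpha_t(\widehat A_\Lambda)-\alpha_{\Lambda,t}(\widehat A_\Lambda)\bigr\|\le\varepsilon\qquad\text{for all } t\in[-t_0,t_0]$$ holds for all sufficiently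 large finite $\Lambda\subset\mathbb Z^\mu$ in the sense of van Hove; that is, there are $m\in\mathbb N$ and $\delta>0$ such that it holds for every nonempty finite $\Lambda$ with $|\{x\in\Lambda:\Lambda_x(m)\not\subset\Lambda\}|\le\delta|\Lambda|$. -/

import Mathlib

open Filter Topology

namespace QuantumSpin

/-- Sites of the cubic lattice `ℤ^μ`. -/
abbrev Lattice (μ : ℕ) : Type := Fin μ → ℤ

/-- The box `{y : |y i - x i| ≤ r for all i}` of radius `r` centered at `x`. -/
noncomputable def box {μ : ℕ} (x : Lattice μ) (r : ℕ) : Finset (Lattice μ) :=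
  Finset.Icc (fun i => x i - (r : ℤ)) (fun i => x i + (r : ℤ))

theorem mem_box {μ : ℕ} {x y : Lattice μ} {r : ℕ} : y ∈ box x r ↔ ∀ i, |y i - x i| ≤ (r : ℤ) := by
  simp only [box, Finset.mem_Icc, Pi.le_def, abs_le, ← forall_and]
  refine forall_congr' fun i => ?_
  omega

/-- A quantum spin system on `ℤ^μ` with spin space `ℂ^d` at each site: a nontrivial unital
C⋆-algebra `A` that contains, for each site, a copy of the full matrix algebra `M_d(ℂ)` (with the
unit of `A` as its unit), such that copies at different sites commute and all the copies together
generate `A` as a C⋆-algebra, together with the space translations, which shift the sites. This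
determines the algebra (as the infinite C⋆-tensor product of copies of `M_d(ℂ)`) and the
translations up to isomorphism. -/
structure SpinSystem (μ d : ℕ) (A : Type*) [CStarAlgebra A] where
  nontrivial : Nontrivial A
  /-- The embedding of the algebra of one site. -/
  site : Lattice μ → (Matrix (Fin d) (Fin d) ℂ →⋆ₐ[ℂ] A)
  commute_site : ∀ x y, x ≠ y → ∀ M N, Commute (site x M) (site y N)
  dense_sites :
    (StarAlgebra.adjoin ℂ (⋃ x, Set.range (site x))).topologicalClosure = ⊤
  /-- The group of space translations `τ_x`. -/
  translation : Multiplicative (Lattice μ) →* (A ≃⋆ₐ[ℂ] A)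
  translation_site : ∀ x y M,
    translation (Multiplicative.ofAdd x) (site y M) = site (y + x) M

namespace SpinSystem

variable {μ d : ℕ} {A : Type*} [CStarAlgebra A] (S : SpinSystem μ d A)

/-- The space translation `τ_x`. -/
def τ (x : Lattice μ) : A ≃⋆ₐ[ℂ] A := S.translation (Multiplicative.ofAdd x)

/-- The algebra `A_Λ` of observables supported in `Λ`, generated by the algebras of the sites
of `Λ`. -/
def localAlgebra (Λ : Finset (Lattice μ)) : StarSubalgebra ℂ A :=
  StarAlgebra.adjoin ℂ (⋃ x ∈ Λ, Set.range (S.site x))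

/-- A local observable: an element of `A_Λ` for some finite `Λ`. -/
def IsLocal (a : A) : Prop := ∃ Λ : Finset (Lattice μ), a ∈ S.localAlgebra Λ

/-- The family `h` of local Hamiltonians is a uniformly bounded finite-range one: each `h x` is
self-adjoint with support in the box of radius `R` centered at `x`, and has norm at most `N`. -/
structure IsLocalHamiltonian (h : Lattice μ → A) (R : ℕ) (N : ℝ) : Prop where
  isSelfAdjoint : ∀ x, IsSelfAdjoint (h x)
  mem_localAlgebra : ∀ x, h x ∈ S.localAlgebra (box x R)
  norm_le : ∀ x, ‖h x‖ ≤ N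

/-- The spatial average `|Λ|⁻¹ ∑_{x ∈ Λ} τ_x(a)`. -/
noncomputable def average (a : A) (Λ : Finset (Lattice μ)) : A :=
  (Λ.card : ℂ)⁻¹ • ∑ x ∈ Λ, S.τ x a

end SpinSystem

section Dynamics

variable {μ : ℕ} {A : Type*} [CStarAlgebra A]

/-- The Hamiltonian `H_Λ = ∑_{x ∈ Λ} h_x` of the finite region `Λ`. -/
def hamiltonian (h : Lattice μ → A) (Λ : Finset (Lattice μ)) : A := ∑ x ∈ Λ, h x

/-- The local (cut-off) Heisenberg time evolution `a ↦ e^{itH_Λ} a e^{-itH_Λ}`. -/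
noncomputable def localEvolution (h : Lattice μ → A) (Λ : Finset (Lattice μ)) (t : ℝ) (a : A) : A :=
  NormedSpace.exp ((Complex.I * (t : ℂ)) • hamiltonian h Λ) * a *
    NormedSpace.exp (-((Complex.I * (t : ℂ)) • hamiltonian h Λ))

/-- A one-parameter group of ⋆-automorphisms of `A`. -/
abbrev TimeEvolution (A : Type*) [CStarAlgebra A] : Type _ :=
  Multiplicative ℝ →* (A ≃⋆ₐ[ℂ] A)

/-- The automorphism `α_t`. -/
def TimeEvolution.at (α : TimeEvolution A) (t : ℝ) : A ≃⋆ₐ[ℂ] A := α (Multiplicative.ofAdd t)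

/-- Strong continuity: `α_t(a) → a` in norm as `t → 0`, for each `a`. -/
def TimeEvolution.IsStronglyContinuous (α : TimeEvolution A) : Prop :=
  ∀ a : A, Tendsto (fun t : ℝ => α.at t a) (𝓝 0) (𝓝 a)

/-- The evolution commutes with all space translations. -/
def TimeEvolution.IsTranslationInvariant {d : ℕ} (α : TimeEvolution A) (S : SpinSystem μ d A) :
    Prop :=
  ∀ (t : ℝ) (x : Lattice μ) (a : A), α.at t (S.τ x a) = S.τ x (α.at t a)

/-- The evolution is approximately inner with respect to `h`: `α_t(a)` is the norm limit of
`α_{Λ,t}(a)` along the net of finite regions `Λ` directed by inclusion, for each `a` and `t`. -/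
def TimeEvolution.IsApproximatelyInner (α : TimeEvolution A) (h : Lattice μ → A) : Prop :=
  ∀ (a : A) (t : ℝ),
    Tendsto (fun Λ : Finset (Lattice μ) => localEvolution h Λ t a) atTop
      (𝓝 (α.at t a))

end Dynamics

/-- The sites of `Λ` whose box of radius `m` is not contained in `Λ`. -/
noncomputable def boundary {μ : ℕ} (m : ℕ) (Λ : Finset (Lattice μ)) : Finset (Lattice μ) :=
  {x ∈ Λ | ¬ box x m ⊆ Λ}

/-- The filter of the van Hove limit on nonempty finite regions `Λ`: for every `m`, the fraction of
sites of `Λ` within distance `m` of the complement of `Λ` tends to zero. -/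
noncomputable def vanHove (μ : ℕ) : Filter (Finset (Lattice μ)) :=
  (⨅ m : ℕ, comap (fun Λ => ((boundary m Λ).card : ℝ) / (Λ.card : ℝ)) (𝓝 0)) ⊓
    𝓟 {Λ | Λ.Nonempty}

end QuantumSpin

/-!
Expanding the difference of the cut-off evolutions in two regions `Λ` and `Λ'` into `n` nested
commutators with interaction terms, nothing distinguishes `Λ` from `Λ'` as long as both contain the
support of the commutators. The remainder is a binomial coefficient times the `n`-th power of the
time, so it converges to zero for short times, uniformly in the position of the observable and in
the regions. Since the evolution in a fixed box stays local (up to norm closure), this locality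
passes from a time `T` to `2T`, hence to all times, and approximate innerness turns it into a
comparison of `α` with the cut-off evolution in `Λ`, uniform over the sites deep inside `Λ`. The
boundary sites contribute at most `2‖a‖ |∂Λ| / |Λ|` to the average, which vanishes in the van Hove
limit.
-/

namespace QuantumSpin

section Lattice

variable {μ : ℕ}

theorem card_box (x : Lattice μ) (r : ℕ) : (box x r).card = (2 * r + 1) ^ μ := by
  have side_card (i : Fin μ) : (x i + (r : ℤ) + 1 - (x i - (r : ℤ))).toNat = 2 * r + 1 := by
    omega
  simp [box, Pi.card_Icc, side_card]

theorem box_mono (x : Lattice μ) : Monotone (box x) := fun r s hrs y hy =>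
  mem_box.2 fun i => (mem_box.1 hy i).trans (by exact_mod_cast hrs)

theorem mem_box_comm {x y : Lattice μ} {r : ℕ} : y ∈ box x r ↔ x ∈ box y r := by
  simp only [mem_box, abs_sub_comm]

theorem mem_box_add {x y z : Lattice μ} {r s : ℕ} (hy : y ∈ box x r) (hz : z ∈ box y s) :
    z ∈ box x (r + s) := by
  refine mem_box.2 fun i => (abs_sub_le _ (y i) _).trans ?_
  have hyi := mem_box.1 hy i
  have hzi := mem_box.1 hz i
  push_cast
  linarith

theorem exists_mem_box_zero (x : Lattice μ) : ∃ r, x ∈ box 0 r := by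
  refine ⟨Finset.univ.sup fun i => (x i).natAbs, mem_box.2 fun i => ?_⟩
  rw [Pi.zero_apply, sub_zero, Int.abs_eq_natAbs]
  exact_mod_cast Finset.le_sup (f := fun i => (x i).natAbs) (Finset.mem_univ i)

/-- The finite region of all sites within `ℓ^∞`-distance `r` of the finite region `X`. It bounds the
supports of the observables produced by interaction terms of range `r`. -/
noncomputable def thickening (r : ℕ) (X : Finset (Lattice μ)) : Finset (Lattice μ) :=
  X.biUnion (box · r)

theorem mem_thickening {r : ℕ} {X : Finset (Lattice μ)} {y : Lattice μ} :
    y ∈ thickening r X ↔ ∃ x ∈ X, y ∈ box x r :=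
  Finset.mem_biUnion

theorem card_thickening_le (r : ℕ) (X : Finset (Lattice μ)) :
    (thickening r X).card ≤ X.card * (2 * r + 1) ^ μ :=
  Finset.card_biUnion_le_card_mul _ _ _ fun x _ => (card_box x r).le

theorem thickening_subset_thickening {r s : ℕ} {X Y : Finset (Lattice μ)} (hrs : r ≤ s)
    (hXY : X ⊆ Y) : thickening r X ⊆ thickening s Y := fun y hy => by
  obtain ⟨x, hx, hyx⟩ := mem_thickening.1 hy
  exact mem_thickening.2 ⟨x, hXY hx, box_mono x hrs hyx⟩

theorem thickening_thickening_subset (r s : ℕ) (X : Finset (Lattice μ)) :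
    thickening s (thickening r X) ⊆ thickening (r + s) X := fun z hz => by
  obtain ⟨y, hy, hzy⟩ := mem_thickening.1 hz
  obtain ⟨x, hx, hyx⟩ := mem_thickening.1 hy
  exact mem_thickening.2 ⟨x, hx, mem_box_add hyx hzy⟩

theorem thickening_box_subset (x : Lattice μ) (r s : ℕ) :
    thickening s (box x r) ⊆ box x (r + s) := fun z hz => by
  obtain ⟨y, hy, hzy⟩ := mem_thickening.1 hz
  exact mem_box_add hy hzy

theorem subset_thickening (r : ℕ) (X : Finset (Lattice μ)) : X ⊆ thickening r X := fun x hx =>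
  mem_thickening.2 ⟨x, hx, mem_box.2 fun i => by simp⟩

theorem card_union_box_le {r p : ℕ} {X : Finset (Lattice μ)} (hp : X.card ≤ p * (2 * r + 1) ^ μ)
    (y : Lattice μ) : (X ∪ box y r).card ≤ (p + 1) * (2 * r + 1) ^ μ := by
  rw [add_one_mul]
  exact (Finset.card_union_le _ _).trans (Nat.add_le_add hp (card_box y r).le)

theorem thickening_union_box_subset {r : ℕ} {X : Finset (Lattice μ)} {y : Lattice μ}
    (hy : y ∈ thickening r X) (s : ℕ) :
    thickening s (X ∪ box y r) ⊆ thickening (2 * r + s) X := by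
  have union_subset : X ∪ box y r ⊆ thickening (2 * r) X := by
    refine Finset.union_subset (subset_thickening _ X) fun z hz => ?_
    obtain ⟨x, hx, hyx⟩ := mem_thickening.1 hy
    exact mem_thickening.2 ⟨x, hx, two_mul r ▸ mem_box_add hyx hz⟩
  exact (thickening_subset_thickening le_rfl union_subset).trans
    (thickening_thickening_subset _ _ X)

end Lattice

namespace SpinSystem

variable {μ d : ℕ} {A : Type*} [CStarAlgebra A] (S : SpinSystem μ d A)

theorem localAlgebra_mono : Monotone S.localAlgebra := fun _ _ hXY =>
  StarAlgebra.adjoin_mono (Set.biUnion_subset_biUnion_left hXY)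

theorem site_mem_localAlgebra {X : Finset (Lattice μ)} {x : Lattice μ} (hx : x ∈ X)
    (M : Matrix (Fin d) (Fin d) ℂ) : S.site x M ∈ S.localAlgebra X :=
  StarAlgebra.subset_adjoin ℂ _ (Set.mem_biUnion hx (Set.mem_range_self M))

theorem localAlgebra_le_iff {X : Finset (Lattice μ)} {B : StarSubalgebra ℂ A} :
    S.localAlgebra X ≤ B ↔ ∀ x ∈ X, ∀ M, S.site x M ∈ B := by
  simp only [localAlgebra, StarAlgebra.adjoin_le_iff, Set.iUnion_subset_iff,
    Set.range_subset_iff, SetLike.mem_coe]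

theorem commute_of_disjoint {X Y : Finset (Lattice μ)} (hXY : Disjoint X Y) {a b : A}
    (ha : a ∈ S.localAlgebra X) (hb : b ∈ S.localAlgebra Y) : Commute a b := by
  have sites_commute : S.localAlgebra Y ≤
      StarSubalgebra.centralizer ℂ (⋃ x ∈ X, Set.range (S.site x)) := by
    refine S.localAlgebra_le_iff.2 fun y hy M => (StarSubalgebra.mem_centralizer_iff ℂ).2 ?_
    simp only [Set.mem_iUnion, Set.mem_range]
    rintro _ ⟨x, hx, L, rfl⟩
    have hxy : x ≠ y := fun e => Finset.disjoint_left.1 hXY hx (e ▸ hy)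
    rw [← map_star]
    exact ⟨(S.commute_site x y hxy L M).eq, (S.commute_site x y hxy (star L) M).eq⟩
  have a_mem := StarAlgebra.adjoin_le_centralizer_centralizer ℂ _ ha
  exact ((StarSubalgebra.mem_centralizer_iff ℂ).1 a_mem b (sites_commute hb)).1.symm

theorem τ_mem_localAlgebra (x : Lattice μ) {X Y : Finset (Lattice μ)}
    (hXY : ∀ y ∈ X, y + x ∈ Y) {a : A} (ha : a ∈ S.localAlgebra X) :
    S.τ x a ∈ S.localAlgebra Y := by
  have le_comap : S.localAlgebra X ≤
      (S.localAlgebra Y).comap (S.τ x : A →⋆ₐ[ℂ] A) := by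
    refine S.localAlgebra_le_iff.2 fun y hy M => ?_
    change S.τ x (S.site y M) ∈ S.localAlgebra Y
    rw [τ, S.translation_site]
    exact S.site_mem_localAlgebra (hXY y hy) M
  exact le_comap ha

theorem τ_mem_localAlgebra_box (x : Lattice μ) {r : ℕ} {a : A}
    (ha : a ∈ S.localAlgebra (box 0 r)) : S.τ x a ∈ S.localAlgebra (box x r) :=
  S.τ_mem_localAlgebra x (fun y hy => mem_box.2 fun i => by simpa using mem_box.1 hy i) ha

theorem exists_mem_localAlgebra_box_norm_sub_lt (a : A) {ε : ℝ} (hε : 0 < ε) :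
    ∃ r, ∃ b ∈ S.localAlgebra (box 0 r), ‖a - b‖ < ε := by
  have boxes_directed : Directed (· ≤ ·) fun r => S.localAlgebra (box 0 r) :=
    (S.localAlgebra_mono.comp (box_mono 0)).directed_le
  have sites_le : StarAlgebra.adjoin ℂ (⋃ x, Set.range (S.site x)) ≤
      ⨆ r, S.localAlgebra (box 0 r) := by
    simp only [StarAlgebra.adjoin_le_iff, Set.iUnion_subset_iff, Set.range_subset_iff]
    intro x M
    obtain ⟨r, hr⟩ := exists_mem_box_zero x
    exact le_iSup (fun r => S.localAlgebra (box 0 r)) r (S.site_mem_localAlgebra hr M)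
  have a_mem_closure : a ∈ closure (StarAlgebra.adjoin ℂ (⋃ x, Set.range (S.site x)) : Set A) := by
    rw [← StarSubalgebra.topologicalClosure_coe, S.dense_sites]
    trivial
  obtain ⟨b, hb, hab⟩ := Metric.mem_closure_iff.1 a_mem_closure ε hε
  have b_mem := sites_le hb
  rw [← SetLike.mem_coe, StarSubalgebra.coe_iSup_of_directed boxes_directed,
    Set.mem_iUnion] at b_mem
  obtain ⟨r, hr⟩ := b_mem
  exact ⟨r, b, hr, dist_eq_norm a b ▸ hab⟩

end SpinSystem

section LocalDynamics

variable {μ : ℕ} {A : Type*} [CStarAlgebra A] {h : Lattice μ → A}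

theorem TimeEvolution.at_add (α : TimeEvolution A) (s t : ℝ) (a : A) :
    α.at (s + t) a = α.at s (α.at t a) := by
  simp only [TimeEvolution.at, ofAdd_add, map_mul, StarAlgEquiv.mul_apply]

/-- The cut-off evolution in the region `Λ` as a one-parameter group of ⋆-automorphisms, available
for self-adjoint interaction terms. -/
noncomputable def localDynamics (hh : ∀ x, IsSelfAdjoint (h x)) (Λ : Finset (Lattice μ)) :
    TimeEvolution A where
  toFun t := Unitary.conjStarAlgAut ℂ A <|
    selfAdjoint.expUnitary (t.toAdd • ⟨hamiltonian h Λ, isSelfAdjoint_sum Λ fun x _ => hh x⟩)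
  map_one' := by simp
  map_mul' s t := by
    rw [toAdd_mul, add_smul, Commute.expUnitary_add, map_mul]
    exact ((Commute.refl _).smul_left _).smul_right _

theorem localDynamics_at (hh : ∀ x, IsSelfAdjoint (h x)) (Λ : Finset (Lattice μ)) (t : ℝ) (a : A) :
    (localDynamics hh Λ).at t a = localEvolution h Λ t a := by
  have star_exp_eq : star (NormedSpace.exp (Complex.I • t • hamiltonian h Λ)) =
      NormedSpace.exp (-(Complex.I • t • hamiltonian h Λ)) := by
    have hH : star (hamiltonian h Λ) = hamiltonian h Λ :=
      (isSelfAdjoint_sum Λ fun x _ => hh x).star_eq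
    rw [NormedSpace.star_exp, star_smul, star_smul, hH]
    simp
  simp only [TimeEvolution.at, localDynamics, MonoidHom.coe_mk, OneHom.coe_mk, toAdd_ofAdd,
    Unitary.conjStarAlgAut_apply, selfAdjoint.expUnitary_coe, selfAdjoint.val_smul,
    star_exp_eq, localEvolution, mul_smul, Complex.coe_smul]

theorem norm_localEvolution (hh : ∀ x, IsSelfAdjoint (h x)) (Λ : Finset (Lattice μ)) (t : ℝ)
    (a : A) : ‖localEvolution h Λ t a‖ = ‖a‖ := by
  rw [← localDynamics_at hh]
  exact StarAlgEquiv.norm_map _ a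

theorem localEvolution_zero (h : Lattice μ → A) (Λ : Finset (Lattice μ)) (a : A) :
    localEvolution h Λ 0 a = a := by
  simp [localEvolution]

theorem localEvolution_neg_left (h : Lattice μ → A) (Λ : Finset (Lattice μ)) (t : ℝ) (a : A) :
    localEvolution (-h) Λ t a = localEvolution h Λ (-t) a := by
  simp [localEvolution, hamiltonian]

theorem localEvolution_mem {B : Subalgebra ℂ A} (hB : IsClosed (B : Set A))
    {Λ : Finset (Lattice μ)} (hΛ : ∀ x ∈ Λ, h x ∈ B) (t : ℝ) {a : A} (ha : a ∈ B) :
    localEvolution h Λ t a ∈ B := by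
  let +nondep : NormedAlgebra ℚ A := .restrictScalars ℚ ℂ A
  have generator_mem : (Complex.I * (t : ℂ)) • hamiltonian h Λ ∈ B :=
    B.smul_mem (B.sum_mem hΛ) _
  exact B.mul_mem (B.mul_mem (NormedSpace.exp_mem hB generator_mem) ha)
    (NormedSpace.exp_mem hB (B.neg_mem generator_mem))

theorem hasDerivAt_localEvolution (h : Lattice μ → A) (Λ : Finset (Lattice μ)) (t : ℝ) (a : A) :
    HasDerivAt (fun s : ℝ => localEvolution h Λ s a)
      (localEvolution h Λ t (Complex.I • ⁅hamiltonian h Λ, a⁆)) t := by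
  set H := Complex.I • hamiltonian h Λ with hH
  have smul_eq (s : ℝ) : (Complex.I * (s : ℂ)) • hamiltonian h Λ = s • H := by
    rw [mul_comm, mul_smul, Complex.coe_smul]
  have lie_eq : Complex.I • ⁅hamiltonian h Λ, a⁆ = H * a - a * H := by
    rw [Ring.lie_def, hH, smul_sub, smul_mul_assoc, mul_smul_comm]
  have left_deriv := hasDerivAt_exp_smul_const (𝕂 := ℝ) H t
  have right_deriv := hasDerivAt_exp_smul_const' (𝕂 := ℝ) (-H) t
  have product_deriv := (left_deriv.mul_const a).fun_mul right_deriv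
  simp only [smul_neg] at product_deriv
  simp only [localEvolution, smul_eq, lie_eq]
  refine product_deriv.congr_deriv ?_
  noncomm_ring

theorem norm_lie_le_two_mul (a b : A) : ‖⁅a, b⁆‖ ≤ 2 * ‖a‖ * ‖b‖ := by
  rw [Ring.lie_def]
  linarith [norm_sub_le (a * b) (b * a), norm_mul_le a b, norm_mul_le b a]

theorem norm_le_of_norm_deriv_le_mul_pow {E : Type*} [NormedAddCommGroup E] [NormedSpace ℝ E]
    {f f' : ℝ → E} (hf : ∀ s, HasDerivAt f (f' s) s) (hf₀ : f 0 = 0) {C : ℝ} {n : ℕ}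
    (hf' : ∀ s, 0 ≤ s → ‖f' s‖ ≤ C * s ^ n) {t : ℝ} (ht : 0 ≤ t) :
    ‖f t‖ ≤ C / (n + 1) * t ^ (n + 1) := by
  have bound_deriv (s : ℝ) :
      HasDerivAt (fun s : ℝ => C / (n + 1) * s ^ (n + 1)) (C * s ^ n) s := by
    refine ((hasDerivAt_pow (n + 1) s).const_mul _).congr_deriv ?_
    push_cast
    field_simp
  refine image_norm_le_of_norm_deriv_right_le_deriv_boundary (a := 0) (b := t)
    (fun s _ => (hf s).continuousAt.continuousWithinAt)
    (fun s _ => (hf s).hasDerivWithinAt) ?_ bound_deriv (fun s hs => hf' s hs.1) ⟨ht, le_rfl⟩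
  simp [hf₀]

end LocalDynamics

namespace SpinSystem.IsLocalHamiltonian

variable {μ d : ℕ} {A : Type*} [CStarAlgebra A] {S : SpinSystem μ d A} {h : Lattice μ → A}
  {R : ℕ} {N : ℝ} {X Λ Λ' : Finset (Lattice μ)} {a : A}

theorem nonneg (hh : S.IsLocalHamiltonian h R N) : 0 ≤ N :=
  (norm_nonneg _).trans (hh.norm_le 0)

theorem neg (hh : S.IsLocalHamiltonian h R N) : S.IsLocalHamiltonian (-h) R N where
  isSelfAdjoint x := (hh.isSelfAdjoint x).neg
  mem_localAlgebra x := neg_mem (hh.mem_localAlgebra x)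
  norm_le x := by simpa using hh.norm_le x

theorem lie_hamiltonian (hh : S.IsLocalHamiltonian h R N) (ha : a ∈ S.localAlgebra X)
    (hΛ : thickening R X ⊆ Λ) :
    ⁅hamiltonian h Λ, a⁆ = ∑ y ∈ thickening R X, ⁅h y, a⁆ := by
  have lie_eq_sum : ⁅hamiltonian h Λ, a⁆ = ∑ y ∈ Λ, ⁅h y, a⁆ := by
    simp only [hamiltonian, Ring.lie_def, Finset.sum_mul, Finset.mul_sum, Finset.sum_sub_distrib]
  refine lie_eq_sum.trans (Finset.sum_subset hΛ fun y _ hy => ?_).symm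
  have box_disjoint : Disjoint (box y R) X := Finset.disjoint_left.2 fun z hz hzX =>
    hy (mem_thickening.2 ⟨z, hzX, mem_box_comm.1 hz⟩)
  exact (S.commute_of_disjoint box_disjoint (hh.mem_localAlgebra y) ha).lie_eq

theorem I_smul_lie_mem_localAlgebra (hh : S.IsLocalHamiltonian h R N) (y : Lattice μ)
    (ha : a ∈ S.localAlgebra X) :
    Complex.I • ⁅h y, a⁆ ∈ S.localAlgebra (X ∪ box y R) := by
  have ha' := S.localAlgebra_mono (Finset.subset_union_left (s₂ := box y R)) ha
  have hy := S.localAlgebra_mono (Finset.subset_union_right (s₁ := X)) (hh.mem_localAlgebra y)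
  rw [Ring.lie_def]
  exact SMulMemClass.smul_mem _ (sub_mem (mul_mem hy ha') (mul_mem ha' hy))

theorem norm_I_smul_lie_le (hh : S.IsLocalHamiltonian h R N) (y : Lattice μ) (a : A) :
    ‖Complex.I • ⁅h y, a⁆‖ ≤ 2 * N * ‖a‖ := by
  rw [norm_smul, Complex.norm_I, one_mul]
  refine (norm_lie_le_two_mul _ _).trans ?_
  gcongr
  exact hh.norm_le y

theorem hasDerivAt_localEvolution_sub (hh : S.IsLocalHamiltonian h R N)
    (ha : a ∈ S.localAlgebra X) (hΛ : thickening R X ⊆ Λ) (hΛ' : thickening R X ⊆ Λ') (t : ℝ) :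
    HasDerivAt (fun s : ℝ => localEvolution h Λ s a - localEvolution h Λ' s a)
      (∑ y ∈ thickening R X, (localEvolution h Λ t (Complex.I • ⁅h y, a⁆) -
        localEvolution h Λ' t (Complex.I • ⁅h y, a⁆))) t := by
  have deriv_eq {Γ : Finset (Lattice μ)} (hΓ : thickening R X ⊆ Γ) :
      localEvolution h Γ t (Complex.I • ⁅hamiltonian h Γ, a⁆) =
        ∑ y ∈ thickening R X, localEvolution h Γ t (Complex.I • ⁅h y, a⁆) := by
    rw [hh.lie_hamiltonian ha hΓ, Finset.smul_sum]
    simp only [← localDynamics_at hh.isSelfAdjoint, map_sum]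
  rw [Finset.sum_sub_distrib, ← deriv_eq hΛ, ← deriv_eq hΛ']
  exact (hasDerivAt_localEvolution h Λ t a).sub (hasDerivAt_localEvolution h Λ' t a)

theorem norm_localEvolution_sub_le_of_lie (hh : S.IsLocalHamiltonian h R N)
    (ha : a ∈ S.localAlgebra X) (hΛ : thickening R X ⊆ Λ) (hΛ' : thickening R X ⊆ Λ')
    {C : ℝ} {n : ℕ}
    (hC : ∀ y ∈ thickening R X, ∀ s : ℝ, 0 ≤ s →
      ‖localEvolution h Λ s (Complex.I • ⁅h y, a⁆) -
        localEvolution h Λ' s (Complex.I • ⁅h y, a⁆)‖ ≤ C * s ^ n)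
    {t : ℝ} (ht : 0 ≤ t) :
    ‖localEvolution h Λ t a - localEvolution h Λ' t a‖ ≤
      (thickening R X).card * C / (n + 1) * t ^ (n + 1) := by
  refine norm_le_of_norm_deriv_le_mul_pow (hh.hasDerivAt_localEvolution_sub ha hΛ hΛ')
    (by simp only [localEvolution_zero, sub_self]) (fun s hs => ?_) ht
  refine (norm_sum_le_of_le _ fun y hy => hC y hy s hs).trans (le_of_eq ?_)
  rw [Finset.sum_const, nsmul_eq_mul, mul_assoc]

end SpinSystem.IsLocalHamiltonian

theorem mul_multichoose_div_succ (p n : ℕ) :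
    (p * (p + 1).multichoose n / (n + 1) : ℝ) = p.multichoose (n + 1) := by
  rw [div_eq_iff (by positivity), Nat.multichoose_eq, Nat.multichoose_eq, Nat.add_right_comm,
    Nat.add_sub_cancel, ← Nat.add_assoc, Nat.add_sub_cancel, mul_comm]
  have choose_eq := Nat.choose_succ_right_eq (p + n) n
  rw [Nat.add_sub_cancel] at choose_eq
  exact_mod_cast choose_eq.symm

theorem multichoose_le_two_pow (p n : ℕ) : p.multichoose n ≤ 2 ^ (p + n) := by
  rw [Nat.multichoose_eq]
  exact (Nat.choose_le_two_pow _ _).trans (Nat.pow_le_pow_right two_pos (Nat.sub_le _ _))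

namespace SpinSystem.IsLocalHamiltonian

variable {μ d : ℕ} {A : Type*} [CStarAlgebra A] {S : SpinSystem μ d A} {h : Lattice μ → A}
  {R : ℕ} {N : ℝ} {X Λ Λ' : Finset (Lattice μ)} {a : A}

theorem norm_localEvolution_sub_le_succ (hh : S.IsLocalHamiltonian h R N) {n p : ℕ}
    (hp : X.card ≤ p * (2 * R + 1) ^ μ) (ha : a ∈ S.localAlgebra X)
    (hΛ : thickening R X ⊆ Λ) (hΛ' : thickening R X ⊆ Λ')
    (hn : ∀ y ∈ thickening R X, ∀ s : ℝ, 0 ≤ s →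
      ‖localEvolution h Λ s (Complex.I • ⁅h y, a⁆) -
        localEvolution h Λ' s (Complex.I • ⁅h y, a⁆)‖ ≤
      2 * ‖Complex.I • ⁅h y, a⁆‖ * (p + 1).multichoose n *
        (2 * N * ((2 * R + 1) ^ μ) ^ 2 * s) ^ n)
    {t : ℝ} (ht : 0 ≤ t) :
    ‖localEvolution h Λ t a - localEvolution h Λ' t a‖ ≤
      2 * ‖a‖ * p.multichoose (n + 1) * (2 * N * ((2 * R + 1) ^ μ) ^ 2 * t) ^ (n + 1) := by
  set V : ℕ := (2 * R + 1) ^ μ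
  have hV : ((2 * R + 1 : ℝ)) ^ μ = V := by simp [V]
  rw [hV] at hn ⊢
  have hN := hh.nonneg
  have card_le : ((thickening R X).card : ℝ) ≤ p * V * V := by
    exact_mod_cast (card_thickening_le R X).trans (Nat.mul_le_mul_right V hp)
  have commutator_bound (y : Lattice μ) (hy : y ∈ thickening R X) (s : ℝ) (hs : 0 ≤ s) :
      ‖localEvolution h Λ s (Complex.I • ⁅h y, a⁆) -
        localEvolution h Λ' s (Complex.I • ⁅h y, a⁆)‖ ≤
      2 * (2 * N * ‖a‖) * (p + 1).multichoose n * (2 * N * V ^ 2) ^ n * s ^ n := by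
    refine (hn y hy s hs).trans ?_
    rw [mul_pow _ s, ← mul_assoc]
    gcongr
    exact hh.norm_I_smul_lie_le y a
  calc ‖localEvolution h Λ t a - localEvolution h Λ' t a‖
      ≤ (thickening R X).card *
          (2 * (2 * N * ‖a‖) * (p + 1).multichoose n * (2 * N * V ^ 2) ^ n) / (n + 1) *
          t ^ (n + 1) :=
        hh.norm_localEvolution_sub_le_of_lie ha hΛ hΛ' commutator_bound ht
    _ ≤ p * V * V * (2 * (2 * N * ‖a‖) * (p + 1).multichoose n * (2 * N * V ^ 2) ^ n) /
          (n + 1) * t ^ (n + 1) := by gcongr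
    _ = 2 * ‖a‖ * (p * (p + 1).multichoose n / (n + 1)) * (2 * N * V ^ 2 * t) ^ (n + 1) := by
        ring
    _ = 2 * ‖a‖ * p.multichoose (n + 1) * (2 * N * V ^ 2 * t) ^ (n + 1) := by
        rw [mul_multichoose_div_succ]

/- Each of the `n` nested commutators with interaction terms enlarges the support by at most one box
of `(2R+1)^μ` sites, so the `k`-th one (from `k = 0`) has at most `(p+k)(2R+1)^{2μ}` nonvanishing
terms; together with the `1/n!` of the iterated time integral this gives the binomial
coefficient. -/
theorem norm_localEvolution_sub_le_of_nonneg (hh : S.IsLocalHamiltonian h R N) (n p : ℕ)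
    (hp : X.card ≤ p * (2 * R + 1) ^ μ) (ha : a ∈ S.localAlgebra X)
    (hΛ : thickening (2 * R * n) X ⊆ Λ) (hΛ' : thickening (2 * R * n) X ⊆ Λ')
    {t : ℝ} (ht : 0 ≤ t) :
    ‖localEvolution h Λ t a - localEvolution h Λ' t a‖ ≤
      2 * ‖a‖ * p.multichoose n * (2 * N * ((2 * R + 1) ^ μ) ^ 2 * t) ^ n := by
  induction n generalizing p X a t with
  | zero =>
    refine (norm_sub_le _ _).trans (le_of_eq ?_)
    rw [norm_localEvolution hh.isSelfAdjoint, norm_localEvolution hh.isSelfAdjoint]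
    simp [two_mul]
  | succ n ih =>
    have thickening_le : thickening R X ⊆ thickening (2 * R * (n + 1)) X :=
      thickening_subset_thickening (by nlinarith) subset_rfl
    refine hh.norm_localEvolution_sub_le_succ hp ha (thickening_le.trans hΛ)
      (thickening_le.trans hΛ') (fun y hy s hs => ?_) ht
    have support_le :
        thickening (2 * R * n) (X ∪ box y R) ⊆ thickening (2 * R * (n + 1)) X := by
      rw [mul_add_one, add_comm]
      exact thickening_union_box_subset hy _
    exact ih (p + 1) (card_union_box_le hp y) (hh.I_smul_lie_mem_localAlgebra y ha)
      (support_le.trans hΛ) (support_le.trans hΛ') hs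

theorem norm_localEvolution_sub_le (hh : S.IsLocalHamiltonian h R N) (n p : ℕ)
    (hp : X.card ≤ p * (2 * R + 1) ^ μ) (ha : a ∈ S.localAlgebra X)
    (hΛ : thickening (2 * R * n) X ⊆ Λ) (hΛ' : thickening (2 * R * n) X ⊆ Λ') (t : ℝ) :
    ‖localEvolution h Λ t a - localEvolution h Λ' t a‖ ≤
      2 * ‖a‖ * p.multichoose n * (2 * N * ((2 * R + 1) ^ μ) ^ 2 * |t|) ^ n := by
  rcases abs_cases t with ⟨abs_eq, ht⟩ | ⟨abs_eq, ht⟩ <;> rw [abs_eq]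
  · exact hh.norm_localEvolution_sub_le_of_nonneg n p hp ha hΛ hΛ' ht
  · have reversed :=
      hh.neg.norm_localEvolution_sub_le_of_nonneg n p hp ha hΛ hΛ' (neg_nonneg.2 ht.le)
    rwa [localEvolution_neg_left, localEvolution_neg_left, neg_neg] at reversed

end SpinSystem.IsLocalHamiltonian

/-- Up to time `T`, the cut-off evolutions of a local observable in any two regions containing a
large enough box around its support agree up to an arbitrarily small multiple of its norm. The size
of the box depends on the diameter of the support, but neither on its position nor on the
regions. -/
def SpinSystem.IsUniformlyLocal {μ d : ℕ} {A : Type*} [CStarAlgebra A] (S : SpinSystem μ d A)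
    (h : Lattice μ → A) (T : ℝ) : Prop :=
  ∀ r : ℕ, ∀ ε > 0, ∃ m : ℕ, ∀ (x : Lattice μ) (Λ Λ' : Finset (Lattice μ)),
    box x m ⊆ Λ → box x m ⊆ Λ' → ∀ a ∈ S.localAlgebra (box x r), ∀ t : ℝ, |t| ≤ T →
      ‖localEvolution h Λ t a - localEvolution h Λ' t a‖ ≤ ε * ‖a‖

section UniformLocality

variable {μ d : ℕ} {A : Type*} [CStarAlgebra A] {S : SpinSystem μ d A} {h : Lattice μ → A}
  {R : ℕ} {N T : ℝ}

theorem SpinSystem.IsUniformlyLocal.mono {T' : ℝ} (hT : S.IsUniformlyLocal h T) (hT' : T' ≤ T) :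
    S.IsUniformlyLocal h T' := fun r ε hε => by
  obtain ⟨m, hm⟩ := hT r ε hε
  exact ⟨m, fun x Λ Λ' hΛ hΛ' a ha t ht => hm x Λ Λ' hΛ hΛ' a ha t (ht.trans hT')⟩

theorem two_mul_multichoose_mul_pow_le {q : ℝ} (hq₀ : 0 ≤ q) (hq : q ≤ 1 / 4) (p n : ℕ) :
    2 * p.multichoose n * q ^ n ≤ 2 ^ (p + 1) * (1 / 2) ^ n := by
  have multichoose_le : (p.multichoose n : ℝ) ≤ 2 ^ (p + n) := by
    exact_mod_cast multichoose_le_two_pow p n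
  calc 2 * p.multichoose n * q ^ n
      ≤ 2 * 2 ^ (p + n) * (1 / 4) ^ n := by gcongr
    _ = 2 ^ (p + 1) * (2 * (1 / 4)) ^ n := by rw [mul_pow]; ring
    _ = 2 ^ (p + 1) * (1 / 2) ^ n := by norm_num

theorem SpinSystem.IsLocalHamiltonian.isUniformlyLocal_of_mul_le
    (hh : S.IsLocalHamiltonian h R N) (hT : 2 * N * ((2 * R + 1) ^ μ) ^ 2 * T ≤ 1 / 4) :
    S.IsUniformlyLocal h T := by
  intro r ε hε
  have hN := hh.nonneg
  set p := (2 * r + 1) ^ μ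
  obtain ⟨n, hn⟩ : ∃ n : ℕ, (2 : ℝ) ^ (p + 1) * (1 / 2) ^ n ≤ ε := by
    have tendsto_zero := (tendsto_pow_atTop_nhds_zero_of_lt_one (r := (1 / 2 : ℝ))
      (by norm_num) (by norm_num)).const_mul (2 ^ (p + 1))
    rw [mul_zero] at tendsto_zero
    exact (tendsto_zero.eventually_le_const hε).exists
  refine ⟨r + 2 * R * n, fun x Λ Λ' hΛ hΛ' a ha t ht => ?_⟩
  have card_le : (box x r).card ≤ p * (2 * R + 1) ^ μ :=
    (card_box x r).trans_le (Nat.le_mul_of_pos_right _ (by positivity))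
  have support_le := thickening_box_subset x r (2 * R * n)
  have rate_le : 2 * N * ((2 * R + 1) ^ μ) ^ 2 * |t| ≤ 1 / 4 :=
    (mul_le_mul_of_nonneg_left ht (by positivity)).trans hT
  calc ‖localEvolution h Λ t a - localEvolution h Λ' t a‖
      ≤ 2 * ‖a‖ * p.multichoose n * (2 * N * ((2 * R + 1) ^ μ) ^ 2 * |t|) ^ n :=
        hh.norm_localEvolution_sub_le n p card_le ha (support_le.trans hΛ)
          (support_le.trans hΛ') t
    _ = 2 * p.multichoose n * (2 * N * ((2 * R + 1) ^ μ) ^ 2 * |t|) ^ n * ‖a‖ := by ring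
    _ ≤ ε * ‖a‖ := by
        gcongr
        exact (two_mul_multichoose_mul_pow_le (by positivity) rate_le p n).trans hn

theorem norm_localEvolution_sub_le_of_mem_topologicalClosure {B : StarSubalgebra ℂ A}
    {Λ Λ' : Finset (Lattice μ)} {t C : ℝ}
    (hB : ∀ b ∈ B, ‖localEvolution h Λ t b - localEvolution h Λ' t b‖ ≤ C * ‖b‖) {b : A}
    (hb : b ∈ B.topologicalClosure) :
    ‖localEvolution h Λ t b - localEvolution h Λ' t b‖ ≤ C * ‖b‖ := by
  have isClosed_bound : IsClosed
      {b : A | ‖localEvolution h Λ t b - localEvolution h Λ' t b‖ ≤ C * ‖b‖} := by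
    unfold localEvolution
    exact isClosed_le (by fun_prop) (by fun_prop)
  exact closure_minimal hB isClosed_bound hb

theorem SpinSystem.IsLocalHamiltonian.localEvolution_mem_topologicalClosure
    (hh : S.IsLocalHamiltonian h R N) {X Y Λ : Finset (Lattice μ)} (hXY : X ⊆ Y)
    (hΛY : thickening R Λ ⊆ Y) {a : A} (ha : a ∈ S.localAlgebra X) (t : ℝ) :
    localEvolution h Λ t a ∈ (S.localAlgebra Y).topologicalClosure := by
  have le_closure := (S.localAlgebra Y).le_topologicalClosure
  refine localEvolution_mem (B := (S.localAlgebra Y).topologicalClosure.toSubalgebra)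
    (S.localAlgebra Y).isClosed_topologicalClosure (fun x hx => ?_) t
    (le_closure (S.localAlgebra_mono hXY ha))
  have box_subset : box x R ⊆ Y := fun y hy => hΛY (mem_thickening.2 ⟨x, hx, hy⟩)
  exact le_closure (S.localAlgebra_mono box_subset (hh.mem_localAlgebra x))

theorem norm_localEvolution_add_self_sub_le (hh : ∀ x, IsSelfAdjoint (h x))
    (Λ Λ' : Finset (Lattice μ)) (s : ℝ) (a b : A) :
    ‖localEvolution h Λ (s + s) a - localEvolution h Λ' (s + s) a‖ ≤
      ‖localEvolution h Λ s a - b‖ + ‖localEvolution h Λ s b - localEvolution h Λ' s b‖ +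
        ‖localEvolution h Λ' s a - b‖ := by
  have telescope : localEvolution h Λ (s + s) a - localEvolution h Λ' (s + s) a =
      localEvolution h Λ s (localEvolution h Λ s a - b) +
        (localEvolution h Λ s b - localEvolution h Λ' s b) -
        localEvolution h Λ' s (localEvolution h Λ' s a - b) := by
    simp only [← localDynamics_at hh, TimeEvolution.at_add, map_sub]
    abel
  rw [telescope, ← norm_localEvolution hh Λ s (localEvolution h Λ s a - b),
    ← norm_localEvolution hh Λ' s (localEvolution h Λ' s a - b)]
  exact (norm_sub_le _ _).trans (add_le_add_left (norm_add_le _ _) _)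

/- Over the first half of the time interval the evolved observable is replaced by its evolution in a
fixed box, which is again an observable (in norm closure) localized in a box of controlled size. -/
theorem SpinSystem.IsUniformlyLocal.two_mul (hh : S.IsLocalHamiltonian h R N)
    (hT : S.IsUniformlyLocal h T) : S.IsUniformlyLocal h (2 * T) := by
  intro r ε hε
  have hε' : 0 < ε / 3 := by positivity
  obtain ⟨m₁, hm₁⟩ := hT r (ε / 3) hε'
  obtain ⟨m₂, hm₂⟩ := hT (max r (m₁ + R)) (ε / 3) hε'
  refine ⟨max m₁ m₂, fun x Λ Λ' hΛ hΛ' a ha t ht => ?_⟩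
  have half_le : |t / 2| ≤ T := by
    rw [abs_div, abs_two]
    linarith
  have box₁ := box_mono x (le_max_left m₁ m₂)
  have box₂ := box_mono x (le_max_right m₁ m₂)
  set b := localEvolution h (box x m₁) (t / 2) a
  have b_mem : b ∈ (S.localAlgebra (box x (max r (m₁ + R)))).topologicalClosure :=
    hh.localEvolution_mem_topologicalClosure (box_mono x (le_max_left _ _))
      ((thickening_box_subset x m₁ R).trans (box_mono x (le_max_right _ _))) ha _
  have first_half {Γ : Finset (Lattice μ)} (hΓ : box x (max m₁ m₂) ⊆ Γ) :
      ‖localEvolution h Γ (t / 2) a - b‖ ≤ ε / 3 * ‖a‖ :=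
    hm₁ x Γ _ (box₁.trans hΓ) subset_rfl a ha _ half_le
  have second_half :
      ‖localEvolution h Λ (t / 2) b - localEvolution h Λ' (t / 2) b‖ ≤ ε / 3 * ‖a‖ := by
    rw [← norm_localEvolution hh.isSelfAdjoint (box x m₁) (t / 2) a]
    exact norm_localEvolution_sub_le_of_mem_topologicalClosure
      (fun c hc => hm₂ x Λ Λ' (box₂.trans hΛ) (box₂.trans hΛ') c hc _ half_le) b_mem
  have halves := norm_localEvolution_add_self_sub_le hh.isSelfAdjoint Λ Λ' (t / 2) a b
  rw [add_halves] at halves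
  linarith [first_half hΛ, first_half hΛ']

theorem SpinSystem.IsLocalHamiltonian.isUniformlyLocal (hh : S.IsLocalHamiltonian h R N) (T : ℝ) :
    S.IsUniformlyLocal h T := by
  have hN := hh.nonneg
  set K := 2 * N * ((2 * R + 1) ^ μ) ^ 2
  have : 0 ≤ K := by positivity
  have doubling (k : ℕ) : S.IsUniformlyLocal h (2 ^ k * (1 / (4 * (K + 1)))) := by
    induction k with
    | zero =>
      refine hh.isUniformlyLocal_of_mul_le ?_
      rw [pow_zero, one_mul, mul_one_div, div_le_iff₀ (by positivity)]
      linarith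
    | succ k ih =>
      rw [pow_succ', mul_assoc]
      exact ih.two_mul hh
  obtain ⟨k, hk⟩ := pow_unbounded_of_one_lt (T * (4 * (K + 1))) one_lt_two
  refine (doubling k).mono ?_
  rw [mul_one_div, le_div_iff₀ (by positivity)]
  exact hk.le

end UniformLocality

section Average

variable {μ d : ℕ} {A : Type*} [CStarAlgebra A] {S : SpinSystem μ d A} {h : Lattice μ → A}
  {R : ℕ} {N : ℝ}

theorem norm_starAlgEquiv_sub_le (φ ψ : A ≃⋆ₐ[ℂ] A) (a b : A) :
    ‖φ a - ψ a‖ ≤ ‖φ b - ψ b‖ + 2 * ‖a - b‖ := by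
  have split : φ a - ψ a = φ b - ψ b + (φ (a - b) - ψ (a - b)) := by
    simp only [map_sub]
    abel
  have remainder := norm_sub_le (φ (a - b)) (ψ (a - b))
  rw [StarAlgEquiv.norm_map, StarAlgEquiv.norm_map, ← two_mul] at remainder
  rw [split]
  exact (norm_add_le _ _).trans (add_le_add_right remainder _)

theorem SpinSystem.IsLocalHamiltonian.exists_norm_at_τ_sub_localEvolution_le
    (hh : S.IsLocalHamiltonian h R N) {α : TimeEvolution A} (hα : α.IsApproximatelyInner h)
    (a : A) {ε : ℝ} (hε : 0 < ε) (T : ℝ) :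
    ∃ m : ℕ, ∀ (x : Lattice μ) (Λ : Finset (Lattice μ)), box x m ⊆ Λ → ∀ t : ℝ, |t| ≤ T →
      ‖α.at t (S.τ x a) - localEvolution h Λ t (S.τ x a)‖ ≤ ε := by
  obtain ⟨r, b, hb, hab⟩ := S.exists_mem_localAlgebra_box_norm_sub_lt a (ε := ε / 4)
    (by positivity)
  obtain ⟨m, hm⟩ := hh.isUniformlyLocal T r (ε / 2 / (‖b‖ + 1)) (by positivity)
  refine ⟨m, fun x Λ hΛ t ht => ?_⟩
  have small : ε / 2 / (‖b‖ + 1) * ‖S.τ x b‖ ≤ ε / 2 := by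
    rw [StarAlgEquiv.norm_map, div_mul_eq_mul_div, div_le_iff₀ (by positivity)]
    gcongr
    linarith
  have local_bound : ‖α.at t (S.τ x b) - localEvolution h Λ t (S.τ x b)‖ ≤ ε / 2 := by
    refine le_of_tendsto ((hα (S.τ x b) t).sub_const (localEvolution h Λ t (S.τ x b))).norm ?_
    filter_upwards [eventually_ge_atTop Λ] with Λ' hΛ'
    exact (hm x Λ' Λ (hΛ.trans hΛ') hΛ _ (S.τ_mem_localAlgebra_box x hb) t ht).trans small
  have approx := norm_starAlgEquiv_sub_le (α.at t) ((localDynamics hh.isSelfAdjoint Λ).at t)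
    (S.τ x a) (S.τ x b)
  rw [localDynamics_at, localDynamics_at, ← map_sub (S.τ x), StarAlgEquiv.norm_map] at approx
  linarith

theorem norm_average_sub_average_le (φ ψ : A ≃⋆ₐ[ℂ] A) (a : A) (m : ℕ) (Λ : Finset (Lattice μ))
    {ε : ℝ} (hε : 0 ≤ ε) (hm : ∀ x, box x m ⊆ Λ → ‖φ (S.τ x a) - ψ (S.τ x a)‖ ≤ ε) :
    ‖φ (S.average a Λ) - ψ (S.average a Λ)‖ ≤
      ε + (boundary m Λ).card / (Λ.card : ℝ) * (2 * ‖a‖) := by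
  have site_bound (x : Lattice μ) :
      ‖φ (S.τ x a) - ψ (S.τ x a)‖ ≤ ε + if box x m ⊆ Λ then 0 else 2 * ‖a‖ := by
    split_ifs with hx
    · simpa using hm x hx
    · have := norm_sub_le (φ (S.τ x a)) (ψ (S.τ x a))
      simp only [StarAlgEquiv.norm_map] at this
      linarith
  calc ‖φ (S.average a Λ) - ψ (S.average a Λ)‖
      = (Λ.card : ℝ)⁻¹ * ‖∑ x ∈ Λ, (φ (S.τ x a) - ψ (S.τ x a))‖ := by
        rw [SpinSystem.average, map_smul, map_smul, ← smul_sub, map_sum, map_sum,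
          ← Finset.sum_sub_distrib, norm_smul, norm_inv, Complex.norm_natCast]
    _ ≤ (Λ.card : ℝ)⁻¹ * ∑ x ∈ Λ, (ε + if box x m ⊆ Λ then 0 else 2 * ‖a‖) := by
        gcongr
        exact norm_sum_le_of_le _ fun x _ => site_bound x
    _ = Λ.card / (Λ.card : ℝ) * ε + (boundary m Λ).card / (Λ.card : ℝ) * (2 * ‖a‖) := by
        have boundary_sum : ∑ x ∈ Λ, (if box x m ⊆ Λ then 0 else 2 * ‖a‖) =
            (boundary m Λ).card * (2 * ‖a‖) := by
          simp only [boundary, ← nsmul_eq_mul, ← Finset.sum_const, Finset.sum_filter, ite_not]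
        rw [Finset.sum_add_distrib, Finset.sum_const, nsmul_eq_mul, boundary_sum]
        ring
    _ ≤ ε + (boundary m Λ).card / (Λ.card : ℝ) * (2 * ‖a‖) := by
        gcongr
        exact mul_le_of_le_one_left hε (div_self_le_one _)

theorem tendsto_card_boundary_div_card (μ m : ℕ) :
    Tendsto (fun Λ : Finset (Lattice μ) => ((boundary m Λ).card : ℝ) / Λ.card) (vanHove μ) (𝓝 0) :=
  tendsto_comap.mono_left (inf_le_left.trans (iInf_le _ m))

end Average

end QuantumSpin

theorem mainTheorem4_general {μ d : ℕ} {A : Type*} [CStarAlgebra A]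
    (S : QuantumSpin.SpinSystem μ d A)
    (h : QuantumSpin.Lattice μ → A) (R : ℕ) (N : ℝ) (hh : S.IsLocalHamiltonian h R N)
    (α : QuantumSpin.TimeEvolution A) (hα_inner : α.IsApproximatelyInner h)
    (A₀ : A) (ε : ℝ) (hε : 0 < ε) (t₀ : ℝ) :
    ∀ᶠ Λ in QuantumSpin.vanHove μ, ∀ t ∈ Set.Icc (-t₀) t₀,
      ‖α.at t (S.average A₀ Λ)
        - QuantumSpin.localEvolution h Λ t (S.average A₀ Λ)‖ ≤ ε := by
  obtain ⟨m, bulk_bound⟩ :=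
    hh.exists_norm_at_τ_sub_localEvolution_le hα_inner A₀ (half_pos hε) t₀
  have boundary_tendsto :=
    (QuantumSpin.tendsto_card_boundary_div_card μ m).mul_const (2 * ‖A₀‖)
  rw [zero_mul] at boundary_tendsto
  filter_upwards [boundary_tendsto.eventually_le_const (half_pos hε)] with Λ boundary_small t ht
  simp only [← QuantumSpin.localDynamics_at hh.isSelfAdjoint] at bulk_bound ⊢
  have average_bound := QuantumSpin.norm_average_sub_average_le (α.at t)
    ((QuantumSpin.localDynamics hh.isSelfAdjoint Λ).at t) A₀ m Λ (half_pos hε).le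
    fun x hx => bulk_bound x Λ hx t (abs_le.2 ht)
  linarith

theorem mainTheorem4 {μ d : ℕ} {A : Type*} [CStarAlgebra A]
    (S : QuantumSpin.SpinSystem μ d A)
    (h : QuantumSpin.Lattice μ → A) (R : ℕ) (N : ℝ) (hh : S.IsLocalHamiltonian h R N)
    (α : QuantumSpin.TimeEvolution A)
    (hα_trans : α.IsTranslationInvariant S)
    (hα_cont : α.IsStronglyContinuous)
    (hα_inner : α.IsApproximatelyInner h)
    (A₀ : A) (hA₀ : S.IsLocal A₀) (ε : ℝ) (hε : 0 < ε) (t₀ : ℝ) (ht₀ : 0 < t₀) :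
    ∀ᶠ Λ in QuantumSpin.vanHove μ, ∀ t ∈ Set.Icc (-t₀) t₀,
      ‖α.at t (S.average A₀ Λ)
        - QuantumSpin.localEvolution h Λ t (S.average A₀ Λ)‖ ≤ ε :=
  mainTheorem4_general S h R N hh α hα_inner A₀ ε hε t₀
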